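/- All graphs are finite simple graphs. The unit sphere $S(x)$ of a vertex $x$ is the subgraph generated by the neighbors of $x$. Inductively, a graph is contractible if it is the one-point graph, or if it has a vertex $x$ such that both $S(x)$ and $G-x$ are contractible. The empty graph is the $(-1)$-sphere, and for $d\ge 0$ a $d$-sphere is a graph for which every unit sphere is a $(d-1)$-sphere and for which removing some vertex leaves a contractible graph; there are no $d$-spheres with $d<-1$. A $d$-graph is a finite simple graph for which every unit sphere is a $(d-1)$-sphere (for $d\ge 0$ the empty graph is thus a $d$-graph). Let $d\ge 0$, let $G=(V,E)$ be a $d$-graph, let $f:V\to\mathbb{R}$ and let $c\in\mathbb{R}$ with $c\notin f(V)$. Let $H=\{f=c\}$ be the graph whose vertices are the simplices (complete subgraphs) of $G$ containing both a vertex with $f-c<0$ and a vertex with $f-c>0$, two of them being adjacent if one is properly contained in the other. Then: (1) $H$ is a $(d-1)$-graph. (2) Assigning to each vertex of $H$ the dimension of the corresponding simplex of $G$ (its number of vertices minus one) is a proper vertex coloring of $H$ with colors in $\{1,\dots,d\}$; in particular $H$ is $d$-colorable. (3) If $H$ is connected (in particular non-empty), its chromatic polynomial $p$ satisfies $p(d)=d!$.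 In general $p(d)=(d!)^{k}$, where $k$ is the number of connected components of $H$ (with $k=0$ if $H$ is empty). -/

import Mathlib

universe u

/-- The unit sphere `S(x)`: the subgraph generated by the neighbours of `x`. -/
abbrev unitSphere {V : Type u} (G : SimpleGraph V) (x : V) : SimpleGraph (G.neighborSet x) :=
  G.induce (G.neighborSet x)

/-- The subgraph generated by all vertices different from `x`. -/
abbrev deleteVertex {V : Type u} (G : SimpleGraph V) (x : V) :
    SimpleGraph ({x}ᶜ : Set V) :=
  G.induce ({x}ᶜ : Set V)

/-- Contractible graphs: the one-point graph is contractible, and `G` is contractible if for some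
vertex `x` both `S(x)` and `G - x` are contractible. -/
inductive IsContractible : ∀ {V : Type u}, SimpleGraph V → Prop
  | point {V : Type u} (G : SimpleGraph V) (hV : Nat.card V = 1) : IsContractible G
  | step {V : Type u} (G : SimpleGraph V) (x : V)
      (hS : IsContractible (unitSphere G x)) (hD : IsContractible (deleteVertex G x)) :
      IsContractible G

/-- `d`-spheres: the empty graph is the `(-1)`-sphere; for `d ≥ 0` a `d`-sphere is a graph all of
whose unit spheres are `(d-1)`-spheres and which becomes contractible after removing some vertex.
There are no `d`-spheres with `d < -1`. -/
inductive IsSphere : ℤ → ∀ {V : Type u}, SimpleGraph V → Prop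
  | empty {V : Type u} (G : SimpleGraph V) (hV : IsEmpty V) : IsSphere (-1) G
  | step {V : Type u} (d : ℤ) (hd : 0 ≤ d) (G : SimpleGraph V)
      (hS : ∀ x : V, IsSphere (d - 1) (unitSphere G x))
      (hD : ∃ x : V, IsContractible (deleteVertex G x)) : IsSphere d G

/-- A `d`-graph is a finite simple graph all of whose unit spheres are `(d-1)`-spheres. -/
structure IsDGraph (d : ℤ) {V : Type u} (G : SimpleGraph V) : Prop where
  finite : Finite V
  sphere : ∀ x : V, IsSphere (d - 1) (unitSphere G x)

/-- The simplices (vertex sets of complete subgraphs) of `G` on which `f - c` changes sign. -/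
abbrev LevelSimplex {V : Type u} (G : SimpleGraph V) (f : V → ℝ) (c : ℝ) : Type u :=
  {s : Finset V // G.IsClique (s : Set V) ∧ (∃ v ∈ s, f v - c < 0) ∧ ∃ v ∈ s, 0 < f v - c}

/-- The level hypersurface `{f = c}`: its vertices are the simplices on which `f - c` changes sign,
two of them being adjacent when one is properly contained in the other. -/
def levelSurface {V : Type u} (G : SimpleGraph V) (f : V → ℝ) (c : ℝ) :
    SimpleGraph (LevelSimplex G f c) where
  Adj s t := s.1 ⊂ t.1 ∨ t.1 ⊂ s.1
  symm := ⟨fun _ _ h => h.symm⟩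
  loopless := ⟨fun _ h => h.elim (fun h => h.ne rfl) (fun h => h.ne rfl)⟩

/-- The dimension of a (nonempty) simplex: its number of vertices minus one. -/
def simplexDim {V : Type u} (s : Finset V) : ℕ := s.card - 1

open scoped Classical in
/-- The chromatic polynomial of a finite graph, by the subset expansion
`∑_{A ⊆ E} (-1)^|A| X^{c(A)}`, where `c(A)` is the number of connected components of the spanning
subgraph with edge set `A`. See `chromaticPolynomial_eval` for its defining property. -/
noncomputable def chromaticPolynomial {V : Type u} [Finite V] (G : SimpleGraph V) :
    Polynomial ℤ :=
  ∑ A ∈ (Set.toFinite G.edgeSet).toFinset.powerset,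
    (-1) ^ A.card *
      Polynomial.X ^ Nat.card (SimpleGraph.fromEdgeSet (A : Set (Sym2 V))).ConnectedComponent

open scoped Classical in
/-- The value of the chromatic polynomial at `k` is the number of proper colorings with `k`
colors. -/
theorem chromaticPolynomial_eval {V : Type u} [Finite V] (G : SimpleGraph V) (k : ℕ) :
    (chromaticPolynomial G).eval (k : ℤ) = (Nat.card (G.Coloring (Fin k)) : ℤ) := by
  have := Fintype.ofFinite V
  set E := (Set.toFinite G.edgeSet).toFinset with hE
  let mono : (V → Fin k) → Sym2 V → Prop := fun g e => ∀ v ∈ e, ∀ w ∈ e, g v = g w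
  have hcomp : ∀ A : Finset (Sym2 V), A ⊆ E →
      ((k : ℤ) ^ Nat.card (SimpleGraph.fromEdgeSet (A : Set (Sym2 V))).ConnectedComponent) =
        ∑ g : V → Fin k, ∏ e ∈ A, (if mono g e then (1 : ℤ) else 0) := by
    intro A hA
    let H := SimpleGraph.fromEdgeSet (A : Set (Sym2 V))
    have h1 : ∀ g : V → Fin k, ∏ e ∈ A, (if mono g e then (1 : ℤ) else 0) =
        if (∀ e ∈ A, mono g e) then 1 else 0 := fun g => by
      rw [Finset.prod_ite_zero]; simp
    simp_rw [h1]
    rw [Finset.sum_boole]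
    have key : Nat.card (H.ConnectedComponent → Fin k) =
        Nat.card {g : V → Fin k // ∀ e ∈ A, mono g e} := by
      refine Nat.card_congr
        { toFun := fun φ => ⟨fun v => φ (H.connectedComponentMk v), ?_⟩
          invFun := fun g => fun C => C.lift g.1 ?_
          left_inv := ?_
          right_inv := ?_ }
      · intro e he v hv w hw
        by_cases hvw : v = w
        · rw [hvw]
        · have : e = s(v, w) := (Sym2.mem_and_mem_iff hvw).1 ⟨hv, hw⟩
          have hadj : H.Adj v w := by
            rw [SimpleGraph.fromEdgeSet_adj]
            exact ⟨by rw [← this]; exact he, hvw⟩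
          exact congrArg φ (SimpleGraph.ConnectedComponent.sound hadj.reachable)
      · intro v w p _
        induction p with
        | nil => rfl
        | cons h p ih =>
          have h' := (SimpleGraph.fromEdgeSet_adj _).1 h
          have := g.2 _ h'.1 _ (Sym2.mem_mk_left _ _) _ (Sym2.mem_mk_right _ _)
          exact this.trans (ih (by simp_all [SimpleGraph.Walk.cons_isPath_iff]))
      · intro φ
        funext C
        induction C using SimpleGraph.ConnectedComponent.ind with
        | h v => rfl
      · intro g
        rfl
    rw [Nat.card_fun, Nat.card_fin,
      Nat.card_eq_fintype_card (α := {g : V → Fin k // ∀ e ∈ A, mono g e}),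
      Fintype.card_subtype] at key
    exact_mod_cast key
  have hcol : Nat.card (G.Coloring (Fin k)) =
      Nat.card {g : V → Fin k // ∀ e ∈ E, ¬ mono g e} := by
    refine Nat.card_congr
      { toFun := fun C => ⟨C, ?_⟩
        invFun := fun g => SimpleGraph.Coloring.mk g.1 ?_
        left_inv := ?_
        right_inv := ?_ }
    · intro e he hm
      induction e with
      | _ v w =>
        rw [hE, Set.Finite.mem_toFinset, SimpleGraph.mem_edgeSet] at he
        exact C.valid he (hm v (Sym2.mem_mk_left _ _) w (Sym2.mem_mk_right _ _))
    · intro v w h heq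
      refine g.2 s(v, w) (by rw [hE, Set.Finite.mem_toFinset]; exact h) ?_
      intro a ha b hb
      rcases Sym2.mem_iff.1 ha with rfl | rfl <;> rcases Sym2.mem_iff.1 hb with rfl | rfl <;>
        simp_all
    · intro C
      rfl
    · intro g
      rfl
  rw [hcol, Nat.card_eq_fintype_card, Fintype.card_subtype]
  have hprod : ∀ g : V → Fin k, (if (∀ e ∈ E, ¬ mono g e) then (1 : ℤ) else 0) =
      ∑ A ∈ E.powerset, (-1) ^ A.card * ∏ e ∈ A, (if mono g e then (1 : ℤ) else 0) := by
    intro g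
    have h1 : ∏ e ∈ E, (1 + -(if mono g e then (1 : ℤ) else 0)) =
        if (∀ e ∈ E, ¬ mono g e) then (1 : ℤ) else 0 := by
      have : ∀ e ∈ E, (1 + -(if mono g e then (1 : ℤ) else 0)) =
          if ¬ mono g e then (1 : ℤ) else 0 := by
        intro e _
        by_cases h : mono g e <;> simp [h]
      rw [Finset.prod_congr rfl this, Finset.prod_ite_zero]
      simp
    rw [← h1, Finset.prod_one_add]
    refine Finset.sum_congr rfl fun A _ => ?_
    rw [Finset.prod_neg]
  have hsum : (∑ g : V → Fin k, if (∀ e ∈ E, ¬ mono g e) then (1 : ℤ) else 0) =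
      ∑ A ∈ E.powerset, (-1) ^ A.card *
        ∑ g : V → Fin k, ∏ e ∈ A, (if mono g e then (1 : ℤ) else 0) := by
    rw [Finset.sum_congr rfl fun g _ => hprod g, Finset.sum_comm]
    simp_rw [Finset.mul_sum]
  rw [Finset.sum_boole] at hsum
  rw [hsum, chromaticPolynomial, Polynomial.eval_finsetSum]
  refine Finset.sum_congr rfl fun A hA => ?_
  rw [← hcomp A (Finset.mem_powerset.1 hA)]
  simp

/-!
The graph `H = {f = c}` is an induced subgraph of the comparability graph of the Boolean lattice of
vertex sets of `G`. All spheres and contractible graphs below are therefore treated as sets of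
vertices of one ambient graph (`ContractibleOn`, `SphereOn`).

**`H` is a `(d - 1)`-graph.** In a partial order, the unit sphere of `t` is the join of the part below
`t` and the part above `t`, and the join of spheres is a sphere (`SphereOn.join`). For a simplex `t`
with `k` vertices in `H`, the part below consists of the proper faces on which `f - c` changes sign,
and is a `(k - 3)`-sphere (`sphereOn_mixed_faces`). The part above consists of the cliques properly
containing `t`; it is the barycentric refinement of the link of `t`, and so a `(d - k)`-sphere
(`SphereOn.cliques_ssuperset`). Together they form a `(d - 2)`-sphere.

The same principle, by induction, identifies the unit spheres of these two posets, the open intervals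
of the Boolean lattice being spheres as well (`sphereOn_Ioo_finset`). What remains each time is that
the poset becomes contractible when one element is removed. This follows from
`ContractibleOn.union_of_inter_Iio` and its dual: elements can be added to a contractible set as long
as the part of this set below (or above) each of them is contractible, for instance because it has a
greatest (or least) element.

**Colorings.** The dimension of simplices colors `H` with `d` colors. In a graph whose unit spheres are
`(d - 2)`-spheres every vertex lies in a clique with `d` vertices, on which a `d`-coloring uses all
colors. By induction on the dimension and connectedness of spheres, two `d`-colorings differ on the
closed star of a vertex only by a permutation of the colors; the permutations for adjacent vertices
agree because the two stars share a clique with `d` vertices (`IsColoringOn.star_eq_of_adj`). Hence the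
colorings of `H` correspond to the choices of one permutation for each connected component
(`natCard_coloring_of_sphereOn`).
-/

/-! ### Contractible sets and spheres inside an ambient graph -/

/-- A set of vertices of `G` that induces a contractible subgraph. Working with sets of vertices of
one ambient graph makes iterated unit spheres and vertex deletions plain set operations. -/
inductive ContractibleOn {V : Type*} (G : SimpleGraph V) : Set V → Prop
  | point (x : V) : ContractibleOn G {x}
  | step (A : Set V) (x : V) (hx : x ∈ A) (hS : ContractibleOn G (A ∩ G.neighborSet x))
      (hD : ContractibleOn G (A \ {x})) : ContractibleOn G A

/-- A set of vertices of `G` that induces an `(n - 1)`-sphere. The index is shifted by one, so that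
the recursion starts with the empty set, the `(-1)`-sphere, at `n = 0`. -/
def SphereOn {V : Type*} (G : SimpleGraph V) : ℕ → Set V → Prop
  | 0, A => A = ∅
  | n + 1, A => (∀ x ∈ A, SphereOn G n (A ∩ G.neighborSet x)) ∧ ∃ x ∈ A, ContractibleOn G (A \ {x})

section Join

variable {V : Type*} {G : SimpleGraph V}

theorem ContractibleOn.nonempty {A : Set V} (h : ContractibleOn G A) : A.Nonempty := by
  cases h with
  | point x => exact ⟨x, rfl⟩
  | step A x hx _ _ => exact ⟨x, hx⟩

theorem SphereOn.nonempty {n : ℕ} {A : Set V} (h : SphereOn G (n + 1) A) : A.Nonempty :=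
  let ⟨x, hx, _⟩ := h.2
  ⟨x, hx⟩

theorem ContractibleOn.insert_of_forall_adj [Finite V] (x : V) (B : Set V)
    (hB : ∀ y ∈ B, G.Adj x y) : ContractibleOn G (insert x B) := by
  induction hn : B.ncard using Nat.strong_induction_on generalizing B with
  | _ n ih =>
    subst hn
    rcases B.eq_empty_or_nonempty with rfl | ⟨y, hy⟩
    · simpa using ContractibleOn.point x
    · have hxy := hB y hy
      refine .step _ y (Or.inr hy) ?_ ?_
      · have : insert x B ∩ G.neighborSet y = insert x (B ∩ G.neighborSet y) :=
          Set.insert_inter_of_mem hxy.symm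
        rw [this]
        refine ih _ (Set.ncard_lt_ncard ⟨Set.inter_subset_left, fun h => ?_⟩ (Set.toFinite _)) _
          (fun z hz => hB z hz.1) rfl
        exact G.loopless.irrefl _ (h hy).2
      · rw [Set.insert_sdiff_of_notMem _ (by simpa using hxy.ne)]
        exact ih _ (Set.ncard_sdiff_singleton_lt_of_mem hy (Set.toFinite _)) _
          (fun z hz => hB z hz.1) rfl

/-- A cone is contractible. -/
theorem ContractibleOn.of_cone [Finite V] {A : Set V} (x : V) (hx : x ∈ A)
    (h : ∀ y ∈ A, y ≠ x → G.Adj x y) : ContractibleOn G A := by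
  have := ContractibleOn.insert_of_forall_adj (G := G) x (A \ {x}) fun y hy => h y hy.1 hy.2
  rwa [Set.insert_sdiff_singleton, Set.insert_eq_of_mem hx] at this

/-- The join of a contractible graph with any graph is contractible. -/
theorem ContractibleOn.join [Finite V] {A : Set V} (hA : ContractibleOn G A) (B : Set V)
    (hAB : ∀ a ∈ A, ∀ b ∈ B, G.Adj a b) : ContractibleOn G (A ∪ B) := by
  induction hA with
  | point x =>
    rw [Set.singleton_union]
    exact .insert_of_forall_adj x B (hAB x rfl)
  | step A x hx _ _ ihS ihD =>
    refine .step _ x (Or.inl hx) ?_ ?_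
    · have hB : B ∩ G.neighborSet x = B := Set.inter_eq_left.2 fun b hb => hAB x hx b hb
      rw [Set.union_inter_distrib_right, hB]
      exact ihS fun a ha => hAB a ha.1
    · have hB : B \ {x} = B := Set.sdiff_singleton_eq_self fun hxB => (hAB x hx x hxB).ne rfl
      rw [Set.union_sdiff_distrib, hB]
      exact ihD fun a ha => hAB a ha.1

/-- The join of two spheres is a sphere. -/
theorem SphereOn.join [Finite V] {m n : ℕ} {A B : Set V} (hA : SphereOn G m A)
    (hB : SphereOn G n B) (hAB : ∀ a ∈ A, ∀ b ∈ B, G.Adj a b) : SphereOn G (m + n) (A ∪ B) := by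
  induction hk : m + n generalizing m n A B with
  | zero =>
    obtain ⟨rfl, rfl⟩ : m = 0 ∧ n = 0 := by omega
    rw [show A = ∅ from hA, show B = ∅ from hB]
    exact Set.union_self ∅
  | succ k ih =>
    refine ⟨?_, ?_⟩
    · rintro x (hx | hx)
      · obtain _ | m := m
        · rw [show A = ∅ from hA] at hx
          exact hx.elim
        rw [Set.union_inter_distrib_right,
          Set.inter_eq_left.2 (show B ⊆ G.neighborSet x from fun b hb => hAB x hx b hb)]
        exact ih (hA.1 x hx) hB (fun a ha => hAB a ha.1) (by omega)
      · obtain _ | n := n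
        · rw [show B = ∅ from hB] at hx
          exact hx.elim
        rw [Set.union_inter_distrib_right,
          Set.inter_eq_left.2 (show A ⊆ G.neighborSet x from fun a ha => (hAB a ha x hx).symm)]
        exact ih hA (hB.1 x hx) (fun a ha b hb => hAB a ha b hb.1) (by omega)
    · obtain _ | m := m
      · obtain rfl : n = k + 1 := by omega
        rw [show A = ∅ from hA, Set.empty_union]
        exact hB.2
      · obtain ⟨x, hx, hD⟩ := hA.2
        refine ⟨x, Or.inl hx, ?_⟩
        rw [Set.union_sdiff_distrib, Set.sdiff_singleton_eq_self fun h => (hAB x hx x h).ne rfl]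
        exact hD.join B fun a ha => hAB a ha.1

end Join

/-! ### Comparability graphs -/

/-- The comparability graph of a partial order. Its cliques are the chains. -/
def comparabilityGraph (P : Type*) [PartialOrder P] : SimpleGraph P where
  Adj a b := a < b ∨ b < a
  symm := ⟨fun _ _ h => h.symm⟩
  loopless := ⟨fun _ h => h.elim (lt_irrefl _) (lt_irrefl _)⟩

section Order

variable {P : Type*} [PartialOrder P]

theorem inter_neighborSet_comparabilityGraph (A : Set P) (x : P) :
    A ∩ (comparabilityGraph P).neighborSet x = (A ∩ Set.Iio x) ∪ (A ∩ Set.Ioi x) := by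
  ext y
  change y ∈ A ∧ (x < y ∨ y < x) ↔ (y ∈ A ∧ y < x) ∨ (y ∈ A ∧ x < y)
  tauto

theorem adj_of_mem_Iio_of_mem_Ioi {A B : Set P} (x : P) :
    ∀ a ∈ A ∩ Set.Iio x, ∀ b ∈ B ∩ Set.Ioi x, (comparabilityGraph P).Adj a b :=
  fun _ ha _ hb => Or.inl (ha.2.trans hb.2)

variable [Finite P]

theorem ContractibleOn.of_isGreatest {A : Set P} {x : P} (h : IsGreatest A x) :
    ContractibleOn (comparabilityGraph P) A :=
  .of_cone x h.1 fun _ hy hne => Or.inr ((h.2 hy).lt_of_ne hne)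

theorem ContractibleOn.of_isLeast {A : Set P} {x : P} (h : IsLeast A x) :
    ContractibleOn (comparabilityGraph P) A :=
  .of_cone x h.1 fun _ hy hne => Or.inl ((h.2 hy).lt_of_ne hne.symm)

/-- Elements may be added to a contractible set if the part of the set below each of them is
contractible: added from the top downwards, each new element has as unit sphere the join of this
part with something above it. -/
theorem ContractibleOn.union_of_inter_Iio {A : Set P}
    (hA : ContractibleOn (comparabilityGraph P) A) (B : Set P) (hAB : Disjoint A B)
    (hB : ∀ b ∈ B, ContractibleOn (comparabilityGraph P) (A ∩ Set.Iio b)) :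
    ContractibleOn (comparabilityGraph P) (A ∪ B) := by
  induction hn : B.ncard generalizing B with
  | zero =>
    rw [(Set.ncard_eq_zero (Set.toFinite _)).1 hn]
    simpa using hA
  | succ n ih =>
    have hne : B.Nonempty := Set.nonempty_of_ncard_ne_zero (by omega)
    obtain ⟨b, hb⟩ := (Set.toFinite B).exists_minimal hne
    refine .step _ b (Or.inr hb.1) ?_ ?_
    · have h : (A ∪ B) ∩ Set.Iio b = A ∩ Set.Iio b := by
        rw [Set.union_inter_distrib_right]
        refine Set.union_eq_left.2 fun y hy => ?_
        exact absurd hy.2 (hb.not_lt hy.1)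
      rw [inter_neighborSet_comparabilityGraph, h]
      exact (hB b hb.1).join _ (adj_of_mem_Iio_of_mem_Ioi b)
    · rw [Set.union_sdiff_distrib,
        Set.sdiff_singleton_eq_self fun h => hAB.notMem_of_mem_left h hb.1]
      refine ih _ (hAB.mono_right Set.sdiff_subset) (fun y hy => hB y hy.1) ?_
      rw [Set.ncard_sdiff_singleton_of_mem hb.1]
      omega

/-- The order dual of `ContractibleOn.union_of_inter_Iio`. -/
theorem ContractibleOn.union_of_inter_Ioi {A : Set P}
    (hA : ContractibleOn (comparabilityGraph P) A) (B : Set P) (hAB : Disjoint A B)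
    (hB : ∀ b ∈ B, ContractibleOn (comparabilityGraph P) (A ∩ Set.Ioi b)) :
    ContractibleOn (comparabilityGraph P) (A ∪ B) := by
  induction hn : B.ncard generalizing B with
  | zero =>
    rw [(Set.ncard_eq_zero (Set.toFinite _)).1 hn]
    simpa using hA
  | succ n ih =>
    have hne : B.Nonempty := Set.nonempty_of_ncard_ne_zero (by omega)
    obtain ⟨b, hb⟩ := (Set.toFinite B).exists_maximal hne
    refine .step _ b (Or.inr hb.1) ?_ ?_
    · have h : (A ∪ B) ∩ Set.Ioi b = A ∩ Set.Ioi b := by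
        rw [Set.union_inter_distrib_right]
        refine Set.union_eq_left.2 fun y hy => ?_
        exact absurd hy.2 (hb.not_gt hy.1)
      rw [inter_neighborSet_comparabilityGraph, h, Set.union_comm]
      exact (hB b hb.1).join _ fun x hx y hy => (adj_of_mem_Iio_of_mem_Ioi b y hy x hx).symm
    · rw [Set.union_sdiff_distrib,
        Set.sdiff_singleton_eq_self fun h => hAB.notMem_of_mem_left h hb.1]
      refine ih _ (hAB.mono_right Set.sdiff_subset) (fun y hy => hB y hy.1) ?_
      rw [Set.ncard_sdiff_singleton_of_mem hb.1]
      omega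

/-- In a partial order, the unit sphere of `x` is the join of the part below and the part above. -/
theorem SphereOn.inter_neighborSet {A : Set P} {x : P} {m n k : ℕ}
    (hl : SphereOn (comparabilityGraph P) m (A ∩ Set.Iio x))
    (hu : SphereOn (comparabilityGraph P) n (A ∩ Set.Ioi x)) (hk : m + n = k) :
    SphereOn (comparabilityGraph P) k (A ∩ (comparabilityGraph P).neighborSet x) := by
  rw [inter_neighborSet_comparabilityGraph, ← hk]
  exact hl.join hu (adj_of_mem_Iio_of_mem_Ioi x)

end Order

/-! ### Spheres of simplices -/

section Simplices

variable {V : Type*}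

/-- An open interval of the Boolean lattice, that is the barycentric refinement of the boundary of
a simplex, is a sphere. -/
theorem sphereOn_Ioo_finset [Finite V] (n : ℕ) (s X : Finset V) (hsX : s ⊆ X)
    (hc : X.card = s.card + n + 1) :
    SphereOn (comparabilityGraph (Finset V)) n (Set.Ioo s X) := by
  classical
  induction n using Nat.strong_induction_on generalizing s X with
  | _ n ih =>
    obtain _ | n := n
    · refine Set.eq_empty_of_forall_notMem fun t ht => ?_
      have h1 := Finset.card_lt_card ht.1
      have h2 := Finset.card_lt_card ht.2
      omega
    refine ⟨fun t ht => ?_, ?_⟩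
    · have h1 := Finset.card_lt_card ht.1
      have h2 := Finset.card_lt_card ht.2
      have hl : Set.Ioo s X ∩ Set.Iio t = Set.Ioo s t := by
        ext y
        exact ⟨fun h => ⟨h.1.1, h.2⟩, fun h => ⟨⟨h.1, h.2.trans ht.2⟩, h.2⟩⟩
      have hu : Set.Ioo s X ∩ Set.Ioi t = Set.Ioo t X := by
        ext y
        exact ⟨fun h => ⟨h.2, h.1.2⟩, fun h => ⟨⟨ht.1.trans h.1, h.2⟩, h.1⟩⟩
      refine SphereOn.inter_neighborSet (m := t.card - s.card - 1) (n := X.card - t.card - 1)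
        ?_ ?_ (by omega)
      · rw [hl]
        exact ih _ (by omega) s t ht.1.le (by omega)
      · rw [hu]
        exact ih _ (by omega) t X ht.2.le (by omega)
    · obtain ⟨v, hvX, hvs⟩ : ∃ v ∈ X, v ∉ s := Finset.exists_mem_notMem_of_card_lt_card (by omega)
      have hcard := Finset.card_erase_of_mem hvX
      have hsub : s ⊆ X.erase v := Finset.subset_erase.2 ⟨hsX, hvs⟩
      refine ⟨X.erase v, ⟨hsub.ssubset_of_ne ?_, Finset.erase_ssubset hvX⟩, ?_⟩
      · intro h
        rw [← h] at hcard
        omega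
      -- Adding `v` maps the sets without `v`, other than `X.erase v`, to the sets with `v`.
      have key : ∀ b : Finset V, b ⊂ X → v ∉ b → b ≠ X.erase v → insert v b ⊂ X := by
        intro b hb hvb hbne
        refine (Finset.insert_subset hvX hb.subset).ssubset_of_ne fun h => hbne ?_
        rw [← h, Finset.erase_insert hvb]
      have hsplit : Set.Ioo s X \ {X.erase v} =
          {t ∈ Set.Ioo s X | v ∈ t} ∪ {t ∈ Set.Ioo s X | v ∉ t ∧ t ≠ X.erase v} := by
        ext t
        have : v ∈ t → t ≠ X.erase v := by
          rintro h rfl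
          simp at h
        simp only [Set.mem_sdiff, Set.mem_singleton_iff, Set.mem_union, Set.mem_ofPred_eq]
        tauto
      rw [hsplit]
      have hsne : s ≠ X.erase v := by
        intro h
        rw [← h] at hcard
        omega
      have hA : IsLeast {t ∈ Set.Ioo s X | v ∈ t} (insert v s) :=
        ⟨⟨⟨Finset.ssubset_insert hvs,
          key s (hsub.trans_ssubset (Finset.erase_ssubset hvX)) hvs hsne⟩,
          Finset.mem_insert_self _ _⟩, fun t ht => Finset.insert_subset ht.2 ht.1.1.subset⟩
      refine (ContractibleOn.of_isLeast hA).union_of_inter_Ioi _ ?_ ?_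
      · exact Set.disjoint_left.2 fun t h1 h2 => h2.2.1 h1.2
      · rintro b ⟨hb, hvb, hbne⟩
        have hlt : b < insert v b := Finset.ssubset_insert hvb
        refine ContractibleOn.of_isLeast (x := insert v b) ⟨⟨⟨⟨hb.1.trans hlt, ?_⟩, ?_⟩, hlt⟩, ?_⟩
        · exact key b hb.2 hvb hbne
        · exact Finset.mem_insert_self _ _
        · exact fun t ht => Finset.insert_subset ht.1.2 (le_of_lt ht.2)

/-- The simplices on which the predicate `p` is not constant. -/
def IsMixed (p : V → Prop) (t : Finset V) : Prop :=
  (∃ v ∈ t, p v) ∧ ∃ v ∈ t, ¬ p v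

theorem IsMixed.two_le_card {p : V → Prop} {t : Finset V} (h : IsMixed p t) : 2 ≤ t.card := by
  obtain ⟨⟨v, hv, hpv⟩, w, hw, hpw⟩ := h
  exact Finset.one_lt_card.2 ⟨v, hv, w, hw, fun h => hpw (h ▸ hpv)⟩

theorem IsMixed.mono {p : V → Prop} {s t : Finset V} (h : IsMixed p s) (hst : s ⊆ t) :
    IsMixed p t :=
  ⟨h.1.imp fun _ h => ⟨hst h.1, h.2⟩, h.2.imp fun _ h => ⟨hst h.1, h.2⟩⟩

theorem isMixed_iff_of_mem {p : V → Prop} {t : Finset V} {v : V} (hv : v ∈ t) :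
    IsMixed p t ↔ ∃ u ∈ t, ¬ (p u ↔ p v) := by
  constructor
  · rintro ⟨⟨a, ha, hpa⟩, b, hb, hpb⟩
    by_cases hpv : p v
    · exact ⟨b, hb, by tauto⟩
    · exact ⟨a, ha, by tauto⟩
  · rintro ⟨u, hu, h⟩
    by_cases hpv : p v
    · exact ⟨⟨v, hv, hpv⟩, u, hu, by tauto⟩
    · exact ⟨⟨u, hu, by tauto⟩, v, hv, hpv⟩

/-- A mixed simplex with at least three vertices has a mixed facet. -/
theorem IsMixed.exists_erase [DecidableEq V] {p : V → Prop} {X : Finset V} (h : IsMixed p X)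
    (hc : 3 ≤ X.card) : ∃ v ∈ X, IsMixed p (X.erase v) := by
  obtain ⟨⟨a, ha, hpa⟩, b, hb, hpb⟩ := h
  obtain ⟨v, hvX, hv⟩ : ∃ v ∈ X, v ∉ ({a, b} : Finset V) :=
    Finset.exists_mem_notMem_of_card_lt_card (lt_of_le_of_lt Finset.card_le_two hc)
  simp only [Finset.mem_insert, Finset.mem_singleton, not_or] at hv
  exact ⟨v, hvX, ⟨a, Finset.mem_erase.2 ⟨Ne.symm hv.1, ha⟩, hpa⟩,
    b, Finset.mem_erase.2 ⟨Ne.symm hv.2, hb⟩, hpb⟩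

/-- The mixed proper faces of `X` that contain the vertex `v` form a contractible set, if some other
vertex of `X` is on the same side as `v`. Those faces of which `v` is the only vertex on its side
have a greatest element, and the others are added from the top downwards. -/
theorem contractibleOn_mixed_faces_mem [Finite V] [DecidableEq V] (p : V → Prop) (X : Finset V)
    (v : V) (hvX : v ∈ X) (hX : IsMixed p (X.erase v)) :
    ContractibleOn (comparabilityGraph (Finset V)) {t | t ⊂ X ∧ IsMixed p t ∧ v ∈ t} := by
  have : DecidablePred fun u => ¬(p u ↔ p v) := Classical.decPred _
  -- the largest face of `t` in which `v` is the only vertex on its side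
  let r : Finset V → Finset V := fun t => insert v (t.filter fun u => ¬ (p u ↔ p v))
  have hr_sub : ∀ t, v ∈ t → r t ⊆ t := fun t hv =>
    Finset.insert_subset hv (Finset.filter_subset _ _)
  have hr_mono : ∀ s t, s ⊆ t → r s ⊆ r t := fun s t h =>
    Finset.insert_subset_insert _ (Finset.filter_subset_filter _ h)
  have hr_idem : ∀ t, r (r t) = r t := by
    intro t
    ext u
    simp only [r, Finset.mem_insert, Finset.mem_filter]
    tauto
  have hr_mem : ∀ t, v ∈ r t := fun t => Finset.mem_insert_self _ _
  have hr_mixed : ∀ t, v ∈ t → IsMixed p t → IsMixed p (r t) := by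
    intro t hv ht
    obtain ⟨u, hu, h⟩ := (isMixed_iff_of_mem hv).1 ht
    exact (isMixed_iff_of_mem (hr_mem t)).2
      ⟨u, Finset.mem_insert_of_mem (Finset.mem_filter.2 ⟨hu, h⟩), h⟩
  have hrX : r X ≠ X := by
    have : ∃ w ∈ X.erase v, (p w ↔ p v) := by
      obtain ⟨⟨a, ha, hpa⟩, b, hb, hpb⟩ := hX
      by_cases hpv : p v
      · exact ⟨a, ha, by tauto⟩
      · exact ⟨b, hb, by tauto⟩
    obtain ⟨w, hw, hpw⟩ := this
    intro h
    have hwX := Finset.mem_of_mem_erase hw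
    rw [← h] at hwX
    rcases Finset.mem_insert.1 hwX with h1 | h1
    · exact Finset.ne_of_mem_erase hw h1
    · exact (Finset.mem_filter.1 h1).2 hpw
  have hsplit : {t | t ⊂ X ∧ IsMixed p t ∧ v ∈ t} =
      {t | t ⊂ X ∧ IsMixed p t ∧ v ∈ t ∧ r t = t} ∪
        {t | t ⊂ X ∧ IsMixed p t ∧ v ∈ t ∧ r t ≠ t} := by
    ext t
    simp only [Set.mem_union, Set.mem_ofPred_eq]
    tauto
  rw [hsplit]
  have hA : IsGreatest {t | t ⊂ X ∧ IsMixed p t ∧ v ∈ t ∧ r t = t} (r X) := by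
    refine ⟨⟨(hr_sub X hvX).ssubset_of_ne hrX, hr_mixed X hvX (hX.mono (Finset.erase_subset _ _)),
      hr_mem X, hr_idem X⟩, ?_⟩
    rintro t ⟨htX, -, -, ht⟩
    rw [← ht]
    exact hr_mono t X htX.subset
  refine (ContractibleOn.of_isGreatest hA).union_of_inter_Iio _ ?_ ?_
  · exact Set.disjoint_left.2 fun t h1 h2 => h2.2.2.2 h1.2.2.2
  · rintro b ⟨hbX, hb, hvb, hrb⟩
    have hlt : r b ⊂ b := (hr_sub b hvb).ssubset_of_ne hrb
    refine ContractibleOn.of_isGreatest (x := r b)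
      ⟨⟨⟨hlt.trans hbX, hr_mixed b hvb hb, hr_mem b, hr_idem b⟩, hlt⟩, ?_⟩
    rintro t ⟨⟨-, -, -, ht⟩, htb⟩
    rw [← ht]
    exact hr_mono t b htb.le

/-- The mixed proper faces of a mixed simplex form a sphere: geometrically, they are the boundary of
the section of the simplex by a hyperplane that separates the two sides. -/
theorem sphereOn_mixed_faces [Finite V] (p : V → Prop) (n : ℕ) (X : Finset V) (hX : IsMixed p X)
    (hc : X.card = n + 2) :
    SphereOn (comparabilityGraph (Finset V)) n {t | t ⊂ X ∧ IsMixed p t} := by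
  classical
  induction n using Nat.strong_induction_on generalizing X with
  | _ n ih =>
    obtain _ | n := n
    · refine Set.eq_empty_of_forall_notMem fun t ht => ?_
      have h1 := Finset.card_lt_card ht.1
      have h2 := ht.2.two_le_card
      omega
    refine ⟨fun t ht => ?_, ?_⟩
    · have h1 := ht.2.two_le_card
      have h2 := Finset.card_lt_card ht.1
      have hl : {t | t ⊂ X ∧ IsMixed p t} ∩ Set.Iio t = {s | s ⊂ t ∧ IsMixed p s} := by
        ext y
        exact ⟨fun h => ⟨h.2, h.1.2⟩, fun h => ⟨⟨h.1.trans ht.1, h.2⟩, h.1⟩⟩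
      have hu : {t | t ⊂ X ∧ IsMixed p t} ∩ Set.Ioi t = Set.Ioo t X := by
        ext y
        exact ⟨fun h => ⟨h.2, h.1.1⟩, fun h => ⟨⟨h.2, ht.2.mono h.1.le⟩, h.1⟩⟩
      refine SphereOn.inter_neighborSet (m := t.card - 2) (n := X.card - t.card - 1)
        ?_ ?_ (by omega)
      · rw [hl]
        exact ih _ (by omega) t ht.2 (by omega)
      · rw [hu]
        exact sphereOn_Ioo_finset _ t X ht.1.subset (by omega)
    · obtain ⟨v, hvX, hv⟩ := hX.exists_erase (by omega)
      refine ⟨X.erase v, ⟨Finset.erase_ssubset hvX, hv⟩, ?_⟩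
      have hsplit : {t | t ⊂ X ∧ IsMixed p t} \ {X.erase v} =
          {t | t ⊂ X ∧ IsMixed p t ∧ v ∈ t} ∪
            {t | t ⊂ X ∧ IsMixed p t ∧ v ∉ t ∧ t ≠ X.erase v} := by
        ext t
        have : v ∈ t → t ≠ X.erase v := by
          rintro h rfl
          simp at h
        simp only [Set.mem_sdiff, Set.mem_singleton_iff, Set.mem_union, Set.mem_ofPred_eq]
        tauto
      rw [hsplit]
      refine (contractibleOn_mixed_faces_mem p X v hvX hv).union_of_inter_Ioi _ ?_ ?_
      · exact Set.disjoint_left.2 fun t h1 h2 => h2.2.2.1 h1.2.2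
      · rintro b ⟨hbX, hb, hvb, hbne⟩
        have hlt : b < insert v b := Finset.ssubset_insert hvb
        refine ContractibleOn.of_isLeast (x := insert v b)
          ⟨⟨⟨?_, hb.mono hlt.le, Finset.mem_insert_self _ _⟩, hlt⟩, ?_⟩
        · refine (Finset.insert_subset hvX hbX.subset).ssubset_of_ne fun h => hbne ?_
          rw [← h, Finset.erase_insert hvb]
        · exact fun t ht => Finset.insert_subset ht.1.2.2 (le_of_lt ht.2)

end Simplices

/-! ### Cliques above a given clique -/

section Cliques

variable {V : Type*} (G : SimpleGraph V)

/-- The common neighbours of the vertices of `s`. -/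
def commonLink (s : Finset V) : Set V := {w | ∀ v ∈ s, G.Adj v w}

/-- The cliques that arise from `s` by adding at least one vertex, all new vertices being in `W`.
For `W` inside the link of `s` this is the barycentric refinement of `W`, shifted by `s`. -/
def cliquesAbove (s : Finset V) (W : Set V) : Set (Finset V) :=
  {t | s ⊂ t ∧ G.IsClique (t : Set V) ∧ ∀ v ∈ t, v ∈ s ∨ v ∈ W}

variable {G}

theorem isClique_coe_insert [DecidableEq V] {s : Finset V} (hs : G.IsClique (s : Set V)) {x : V}
    (hx : x ∈ commonLink G s) : G.IsClique ((insert x s : Finset V) : Set V) := by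
  rw [Finset.coe_insert]
  exact hs.insert fun v hv _ => (hx v hv).symm

theorem notMem_of_mem_commonLink {s : Finset V} {x : V} (hx : x ∈ commonLink G s) : x ∉ s :=
  fun h => (hx x h).ne rfl

theorem commonLink_insert [DecidableEq V] (s : Finset V) (x : V) :
    commonLink G (insert x s) = commonLink G s ∩ G.neighborSet x := by
  ext w
  simp only [commonLink, Finset.mem_insert, forall_eq_or_imp, Set.mem_ofPred_eq, Set.mem_inter_iff,
    SimpleGraph.mem_neighborSet]
  tauto

/-- Cliques that contain `x` in addition to `s` and something else can be added to the cliques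
avoiding `x`: removing `x` yields the largest clique of the latter kind below such a clique. -/
theorem ContractibleOn.cliquesAbove_diff_insert [Finite V] [DecidableEq V] {s : Finset V}
    {W : Set V} {x : V} (hx : x ∉ s)
    (h : ContractibleOn (comparabilityGraph (Finset V)) (cliquesAbove G s (W \ {x}))) :
    ContractibleOn (comparabilityGraph (Finset V)) (cliquesAbove G s W \ {insert x s}) := by
  have hsplit : cliquesAbove G s W \ {insert x s} =
      cliquesAbove G s (W \ {x}) ∪ {t ∈ cliquesAbove G s W | x ∈ t ∧ t ≠ insert x s} := by
    ext t
    constructor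
    · rintro ⟨⟨h1, h2, h3⟩, hne⟩
      by_cases hxt : x ∈ t
      · exact Or.inr ⟨⟨h1, h2, h3⟩, hxt, hne⟩
      · refine Or.inl ⟨h1, h2, fun v hv => (h3 v hv).imp_right fun hW => ⟨hW, ?_⟩⟩
        rintro rfl
        exact hxt hv
    · rintro (⟨h1, h2, h3⟩ | ⟨h1, -, h2⟩)
      · refine ⟨⟨h1, h2, fun v hv => (h3 v hv).imp_right fun hW => hW.1⟩, ?_⟩
        rintro rfl
        rcases h3 x (Finset.mem_insert_self _ _) with h | h
        · exact hx h
        · exact h.2 rfl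
      · exact ⟨h1, h2⟩
  have hxA : ∀ t ∈ cliquesAbove G s (W \ {x}), x ∉ t := by
    rintro t ⟨-, -, h3⟩ hxt
    rcases h3 x hxt with h | h
    · exact hx h
    · exact h.2 rfl
  rw [hsplit]
  refine h.union_of_inter_Iio _ (Set.disjoint_left.2 fun t h1 h2 => hxA t h1 h2.2.1) ?_
  rintro b ⟨⟨hsb, hb, hbW⟩, hxb, hbne⟩
  refine ContractibleOn.of_isGreatest (x := b.erase x) ⟨⟨⟨?_, ?_, ?_⟩, ?_⟩, ?_⟩
  · refine (Finset.subset_erase.2 ⟨hsb.subset, hx⟩).ssubset_of_ne fun h => hbne ?_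
    rw [h, Finset.insert_erase hxb]
  · exact hb.subset (Finset.coe_subset.2 (Finset.erase_subset _ _))
  · exact fun v hv => (hbW v (Finset.mem_of_mem_erase hv)).imp_right
      fun h => ⟨h, Finset.ne_of_mem_erase hv⟩
  · exact Finset.erase_ssubset hxb
  · exact fun t ht => Finset.subset_erase.2 ⟨le_of_lt ht.2, hxA t ht.1⟩

/-- The barycentric refinement of a contractible graph is contractible. -/
theorem ContractibleOn.cliquesAbove [Finite V] {W : Set V} (hW : ContractibleOn G W) (s : Finset V)
    (hs : G.IsClique (s : Set V)) (hsW : W ⊆ commonLink G s) :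
    ContractibleOn (comparabilityGraph (Finset V)) (cliquesAbove G s W) := by
  classical
  induction hW generalizing s with
  | point x =>
    have hx : x ∈ commonLink G s := hsW rfl
    refine ContractibleOn.of_isLeast (x := insert x s)
      ⟨⟨Finset.ssubset_insert (notMem_of_mem_commonLink hx), isClique_coe_insert hs hx, ?_⟩, ?_⟩
    · exact fun v hv => (Finset.mem_insert.1 hv).symm
    · rintro t ⟨hst, -, ht⟩
      obtain ⟨v, hvt, hvs⟩ := Finset.exists_of_ssubset hst
      obtain rfl : v = x := (ht v hvt).resolve_left hvs
      exact Finset.insert_subset hvt hst.subset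
  | step W x hxW _ _ ihS ihD =>
    have hx : x ∈ commonLink G s := hsW hxW
    have hxs := notMem_of_mem_commonLink hx
    refine .step _ (insert x s) ⟨Finset.ssubset_insert hxs, isClique_coe_insert hs hx, ?_⟩ ?_ ?_
    · rintro v hv
      rcases Finset.mem_insert.1 hv with rfl | h
      · exact Or.inr hxW
      · exact Or.inl h
    · have : _root_.cliquesAbove G s W ∩
          (comparabilityGraph (Finset V)).neighborSet (insert x s) =
          _root_.cliquesAbove G (insert x s) (W ∩ G.neighborSet x) := by
        ext t
        constructor
        · rintro ⟨⟨hst, ht, htW⟩, h | h⟩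
          · refine ⟨h, ht, fun v hv => ?_⟩
            by_cases hvx : v = x
            · exact Or.inl (Finset.mem_insert.2 (Or.inl hvx))
            · refine (htW v hv).imp Finset.mem_insert_of_mem fun hvW => ⟨hvW, ?_⟩
              exact ht (h.subset (Finset.mem_insert_self _ _)) hv (Ne.symm hvx)
          · -- nothing lies strictly between `s` and `insert x s`
            have h1 := Finset.card_lt_card hst
            have h2 := Finset.card_lt_card h
            rw [Finset.card_insert_of_notMem hxs] at h2
            omega
        · rintro ⟨hst, ht, htW⟩
          refine ⟨⟨(Finset.ssubset_insert hxs).trans hst, ht, fun v hv => ?_⟩, Or.inl hst⟩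
          rcases htW v hv with h | h
          · rcases Finset.mem_insert.1 h with rfl | h
            · exact Or.inr hxW
            · exact Or.inl h
          · exact Or.inr h.1
      rw [this]
      refine ihS _ (isClique_coe_insert hs hx) ?_
      rw [commonLink_insert]
      exact Set.inter_subset_inter_left _ hsW
    · exact (ihD s hs fun w hw => hsW hw.1).cliquesAbove_diff_insert hxs

/-- Each vertex added to a clique replaces its link by a unit sphere in that link. -/
theorem SphereOn.commonLink_of_subset {s t : Finset V} (hst : s ⊆ t)
    (ht : G.IsClique (t : Set V)) {n : ℕ} (hs : SphereOn G n (commonLink G s)) :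
    ∃ m, m + t.card = n + s.card ∧ SphereOn G m (commonLink G t) := by
  classical
  induction hk : t.card - s.card generalizing n s with
  | zero =>
    obtain rfl := Finset.eq_of_subset_of_card_le hst (by omega)
    exact ⟨n, rfl, hs⟩
  | succ k ih =>
    obtain ⟨x, hxt, hxs⟩ : ∃ x ∈ t, x ∉ s :=
      Finset.exists_mem_notMem_of_card_lt_card (by omega)
    have hx : x ∈ commonLink G s := fun v hv => ht (hst hv) hxt fun h => hxs (h ▸ hv)
    obtain _ | n := n
    · rw [show commonLink G s = ∅ from hs] at hx
      exact hx.elim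
    have hcard := Finset.card_insert_of_notMem hxs
    obtain ⟨m, hm, h⟩ := ih (s := insert x s) (n := n) (Finset.insert_subset hxt hst)
      (by rw [commonLink_insert]; exact hs.1 x hx) (by omega)
    exact ⟨m, by omega, h⟩

/-- The cliques properly containing a clique `s` form the barycentric refinement of the link of `s`,
and so a sphere if the link is a sphere. -/
theorem SphereOn.cliques_ssuperset [Finite V] (n : ℕ) (s : Finset V) (hs : G.IsClique (s : Set V))
    (hl : SphereOn G n (commonLink G s)) :
    SphereOn (comparabilityGraph (Finset V)) n {t | s ⊂ t ∧ G.IsClique (t : Set V)} := by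
  classical
  have hmem : ∀ t : Finset V, s ⊂ t → G.IsClique (t : Set V) →
      ∀ v ∈ t, v ∈ s ∨ v ∈ commonLink G s :=
    fun t hst ht v hv => or_iff_not_imp_left.2 fun hvs w hw =>
      ht (hst.subset hw) hv fun h => hvs (h ▸ hw)
  induction n using Nat.strong_induction_on generalizing s with
  | _ n ih =>
    obtain _ | n := n
    · refine Set.eq_empty_of_forall_notMem fun t ht => ?_
      obtain ⟨v, hvt, hvs⟩ := Finset.exists_of_ssubset ht.1
      have := (hmem t ht.1 ht.2 v hvt).resolve_left hvs
      rw [show commonLink G s = ∅ from hl] at this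
      exact this
    refine ⟨fun t ht => ?_, ?_⟩
    · obtain ⟨m, hm, hlt⟩ := hl.commonLink_of_subset ht.1.subset ht.2
      have hc := Finset.card_lt_card ht.1
      have hlow : {t | s ⊂ t ∧ G.IsClique (t : Set V)} ∩ Set.Iio t = Set.Ioo s t := by
        ext y
        exact ⟨fun h => ⟨h.1.1, h.2⟩,
          fun h => ⟨⟨h.1, ht.2.subset (Finset.coe_subset.2 h.2.le)⟩, h.2⟩⟩
      have hup : {t | s ⊂ t ∧ G.IsClique (t : Set V)} ∩ Set.Ioi t =
          {y | t ⊂ y ∧ G.IsClique (y : Set V)} := by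
        ext y
        exact ⟨fun h => ⟨h.2, h.1.2⟩, fun h => ⟨⟨ht.1.trans h.1, h.2⟩, h.1⟩⟩
      refine SphereOn.inter_neighborSet (m := t.card - s.card - 1) (n := m) ?_ ?_ (by omega)
      · rw [hlow]
        exact sphereOn_Ioo_finset _ s t ht.1.subset (by omega)
      · rw [hup]
        refine ih m (by omega) t ht.2 hlt fun y hty hy v hv => ?_
        exact or_iff_not_imp_left.2 fun hvt w hw => hy (hty.subset hw) hv fun h => hvt (h ▸ hw)
    · obtain ⟨x, hx, hD⟩ := hl.2
      have hxs := notMem_of_mem_commonLink hx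
      refine ⟨insert x s, ⟨Finset.ssubset_insert hxs, isClique_coe_insert hs hx⟩, ?_⟩
      have : {t | s ⊂ t ∧ G.IsClique (t : Set V)} = cliquesAbove G s (commonLink G s) := by
        ext t
        exact ⟨fun h => ⟨h.1, h.2, hmem t h.1 h.2⟩, fun h => ⟨h.1, h.2.1⟩⟩
      rw [this]
      exact (hD.cliquesAbove s hs Set.sdiff_subset).cliquesAbove_diff_insert hxs

end Cliques

/-! ### Induced subgraphs as sets of vertices -/

section Translation

variable {V W : Type u} {G : SimpleGraph V} {H : SimpleGraph W}

/-- The unit sphere of `x`, as part of an ambient graph containing `H`. -/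
def unitSphereEmbedding (φ : H ↪g G) (x : W) : unitSphere H x ↪g G :=
  (SimpleGraph.Embedding.induce (G := H) (H.neighborSet x)).trans φ

/-- The complement of `x`, as part of an ambient graph containing `H`. -/
def deleteVertexEmbedding (φ : H ↪g G) (x : W) : deleteVertex H x ↪g G :=
  (SimpleGraph.Embedding.induce (G := H) ({x}ᶜ : Set W)).trans φ

theorem range_unitSphereEmbedding (φ : H ↪g G) (x : W) :
    Set.range (unitSphereEmbedding φ x) = Set.range φ ∩ G.neighborSet (φ x) := by
  ext y
  constructor
  · rintro ⟨⟨z, hz⟩, rfl⟩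
    exact ⟨⟨z, rfl⟩, φ.map_adj_iff.2 hz⟩
  · rintro ⟨⟨z, rfl⟩, hz⟩
    exact ⟨⟨z, φ.map_adj_iff.1 hz⟩, rfl⟩

theorem range_deleteVertexEmbedding (φ : H ↪g G) (x : W) :
    Set.range (deleteVertexEmbedding φ x) = Set.range φ \ {φ x} := by
  ext y
  constructor
  · rintro ⟨⟨z, hz⟩, rfl⟩
    exact ⟨⟨z, rfl⟩, fun h => hz (φ.injective h)⟩
  · rintro ⟨⟨z, rfl⟩, hz⟩
    exact ⟨⟨z, fun h => hz (congrArg φ h)⟩, rfl⟩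

theorem IsContractible.contractibleOn_range (hH : IsContractible H) (φ : H ↪g G) :
    ContractibleOn G (Set.range φ) := by
  induction hH with
  | point H hW =>
    obtain ⟨hs, ⟨x⟩⟩ := Nat.card_eq_one_iff_unique.1 hW
    have : Set.range φ = {φ x} := by
      ext y
      exact ⟨fun ⟨z, hz⟩ => by rw [← hz, Subsingleton.elim z x]; rfl, fun h => ⟨x, h.symm⟩⟩
    rw [this]
    exact .point _
  | step H x _ _ ihS ihD =>
    refine .step _ (φ x) ⟨x, rfl⟩ ?_ ?_
    · rw [← range_unitSphereEmbedding]
      exact ihS _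
    · rw [← range_deleteVertexEmbedding]
      exact ihD _

theorem ContractibleOn.isContractible {A : Set V} (hA : ContractibleOn G A) :
    ∀ {W : Type u} {H : SimpleGraph W} (φ : H ↪g G), Set.range φ = A → IsContractible H := by
  induction hA with
  | point x =>
    intro W H φ hφ
    have h : ∀ a, φ a = x := fun a => by simpa [hφ] using Set.mem_range_self (f := φ) a
    refine .point H (Nat.card_eq_one_iff_unique.2 ⟨⟨fun a b => φ.injective ?_⟩, ?_⟩)
    · rw [h a, h b]
    · obtain ⟨w, -⟩ : x ∈ Set.range φ := hφ ▸ rfl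
      exact ⟨w⟩
  | step A y hy _ _ ihS ihD =>
    intro W H φ hφ
    obtain ⟨x, rfl⟩ : y ∈ Set.range φ := hφ ▸ hy
    subst hφ
    exact .step H x (ihS _ (range_unitSphereEmbedding φ x)) (ihD _ (range_deleteVertexEmbedding φ x))

theorem IsSphere.sphereOn_range {d : ℤ} (hH : IsSphere d H) (φ : H ↪g G) :
    ∃ n : ℕ, (n : ℤ) = d + 1 ∧ SphereOn G n (Set.range φ) := by
  induction hH with
  | empty H hW => exact ⟨0, by norm_num, Set.range_eq_empty _⟩
  | step d hd H _ hD ihS =>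
    obtain ⟨n, rfl⟩ := Int.eq_ofNat_of_zero_le hd
    refine ⟨n + 1, by push_cast; rfl, ?_, ?_⟩
    · rintro _ ⟨x, rfl⟩
      obtain ⟨m, hm, h⟩ := ihS x (unitSphereEmbedding φ x)
      obtain rfl : m = n := by simpa using hm
      rwa [range_unitSphereEmbedding] at h
    · obtain ⟨x, hx⟩ := hD
      refine ⟨φ x, ⟨x, rfl⟩, ?_⟩
      rw [← range_deleteVertexEmbedding]
      exact hx.contractibleOn_range _

theorem SphereOn.isSphere {n : ℕ} (φ : H ↪g G) (h : SphereOn G n (Set.range φ)) :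
    IsSphere ((n : ℤ) - 1) H := by
  induction n generalizing W with
  | zero =>
    have := Set.range_eq_empty_iff.1 (show Set.range φ = ∅ from h)
    simpa using IsSphere.empty H this
  | succ n ih =>
    refine .step _ (by push_cast; omega) H (fun x => ?_) ?_
    · have := ih (unitSphereEmbedding φ x)
        (by rw [range_unitSphereEmbedding]; exact h.1 _ ⟨x, rfl⟩)
      simpa using this
    · obtain ⟨_, ⟨x, rfl⟩, hx⟩ := h.2
      exact ⟨x, hx.isContractible _ (range_deleteVertexEmbedding φ x)⟩

theorem IsDGraph.sphereOn_neighborSet {d : ℤ} (hG : IsDGraph d G) (x : V) :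
    ∃ n : ℕ, (n : ℤ) = d ∧ SphereOn G n (G.neighborSet x) := by
  obtain ⟨n, hn, h⟩ :=
    (hG.sphere x).sphereOn_range (unitSphereEmbedding SimpleGraph.Embedding.refl x)
  rw [range_unitSphereEmbedding] at h
  refine ⟨n, by omega, ?_⟩
  have hr : Set.range (SimpleGraph.Embedding.refl : G ↪g G) = Set.univ :=
    Set.range_eq_univ.2 fun y => ⟨y, rfl⟩
  rw [hr, Set.univ_inter] at h
  exact h

end Translation

/-! ### Minimal colorings -/

section Colorings

variable {V α : Type*} {G : SimpleGraph V}

/-- Connectedness, expressed by properties that propagate along edges, passes from `A \ {x}` to `A`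
if `x` has a neighbour in `A`. -/
theorem forall_of_adj_of_diff_singleton {A : Set V} {x : V} (hx : x ∈ A)
    (hS : (A ∩ G.neighborSet x).Nonempty) (P : V → Prop)
    (hP : ∀ u ∈ A, ∀ v ∈ A, G.Adj u v → P u → P v)
    (hD : ∀ u ∈ A \ {x}, ∀ v ∈ A \ {x}, P u → P v) : ∀ u ∈ A, ∀ v ∈ A, P u → P v := by
  obtain ⟨y, hyA, hxy⟩ := hS
  have hyx : y ≠ x := Ne.symm (SimpleGraph.Adj.ne hxy)
  intro u hu v hv h
  by_cases hux : u = x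
  · by_cases hvx : v = x
    · rwa [hvx, ← hux]
    · exact hD y ⟨hyA, hyx⟩ v ⟨hv, hvx⟩ (hP x hx y hyA hxy (hux ▸ h))
  · by_cases hvx : v = x
    · rw [hvx]
      exact hP y hyA x hx (SimpleGraph.Adj.symm hxy) (hD u ⟨hu, hux⟩ y ⟨hyA, hyx⟩ h)
    · exact hD u ⟨hu, hux⟩ v ⟨hv, hvx⟩ h

/-- Contractible graphs are connected. -/
theorem ContractibleOn.forall_of_adj {A : Set V} (hA : ContractibleOn G A) (P : V → Prop)
    (hP : ∀ u ∈ A, ∀ v ∈ A, G.Adj u v → P u → P v) : ∀ u ∈ A, ∀ v ∈ A, P u → P v := by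
  induction hA with
  | point x =>
    rintro u rfl v rfl h
    exact h
  | step A x hx hS _ _ ihD =>
    exact forall_of_adj_of_diff_singleton hx hS.nonempty P hP
      (ihD fun u hu v hv => hP u hu.1 v hv.1)

/-- Spheres of positive dimension are connected. -/
theorem SphereOn.forall_of_adj {n : ℕ} {A : Set V} (hA : SphereOn G (n + 2) A) (P : V → Prop)
    (hP : ∀ u ∈ A, ∀ v ∈ A, G.Adj u v → P u → P v) : ∀ u ∈ A, ∀ v ∈ A, P u → P v := by
  obtain ⟨x, hx, hD⟩ := hA.2
  exact forall_of_adj_of_diff_singleton hx (hA.1 x hx).nonempty P hP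
    (hD.forall_of_adj P fun u hu v hv => hP u hu.1 v hv.1)

/-- The function `C` restricts to a proper coloring of `A` with colors in `S`. -/
structure IsColoringOn (G : SimpleGraph V) (A : Set V) (S : Finset α) (C : V → α) : Prop where
  mem : ∀ v ∈ A, C v ∈ S
  ne : ∀ u ∈ A, ∀ v ∈ A, G.Adj u v → C u ≠ C v

theorem IsColoringOn.inter_neighborSet [DecidableEq α] {A : Set V} {S : Finset α} {C : V → α}
    (hC : IsColoringOn G A S C) {x : V} (hx : x ∈ A) :
    IsColoringOn G (A ∩ G.neighborSet x) (S.erase (C x)) C where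
  mem v hv := Finset.mem_erase.2 ⟨(hC.ne x hx v hv.1 hv.2).symm, hC.mem v hv.1⟩
  ne u hu v hv := hC.ne u hu.1 v hv.1

/-- A coloring of an `(n - 1)`-sphere with only `n` colors uses every color, because some clique
has `n` vertices. -/
theorem SphereOn.exists_color_eq [DecidableEq α] {n : ℕ} {A : Set V} (hA : SphereOn G n A)
    {S : Finset α} (hS : S.card = n) {C : V → α} (hC : IsColoringOn G A S C) {i : α}
    (hi : i ∈ S) : ∃ v ∈ A, C v = i := by
  induction n generalizing A S with
  | zero =>
    rw [Finset.card_eq_zero.1 hS] at hi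
    simp at hi
  | succ n ih =>
    obtain ⟨x, hx⟩ := hA.nonempty
    by_cases hxi : C x = i
    · exact ⟨x, hx, hxi⟩
    · obtain ⟨v, hv, hvi⟩ := ih (hA.1 x hx)
        (by rw [Finset.card_erase_of_mem (hC.mem x hx), hS, Nat.add_sub_cancel])
        (hC.inter_neighborSet hx) (Finset.mem_erase.2 ⟨Ne.symm hxi, hi⟩)
      exact ⟨v, hv.1, hvi⟩

/-- If the unit spheres are `(n - 1)`-spheres, then every color occurs on the closed star of each
vertex. -/
theorem IsColoringOn.exists_mem_star [DecidableEq α] {n : ℕ} {A : Set V}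
    (hA : ∀ x ∈ A, SphereOn G n (A ∩ G.neighborSet x)) {S : Finset α} (hS : S.card = n + 1)
    {C : V → α} (hC : IsColoringOn G A S C) {x : V} (hx : x ∈ A) {i : α} (hi : i ∈ S) :
    ∃ w ∈ A, (w = x ∨ G.Adj x w) ∧ C w = i := by
  by_cases hxi : C x = i
  · exact ⟨x, hx, Or.inl rfl, hxi⟩
  · obtain ⟨v, hv, hvi⟩ := (hA x hx).exists_color_eq
      (by rw [Finset.card_erase_of_mem (hC.mem x hx), hS, Nat.add_sub_cancel])
      (hC.inter_neighborSet hx) (Finset.mem_erase.2 ⟨Ne.symm hxi, hi⟩)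
    exact ⟨v, hv.1, Or.inr hv.2, hvi⟩

/-- Let `C'` be, on each closed star, the composition of `C` with some map of colors. A map that
works on the star of `u` then also works on the star of a neighbour `v`, because the two stars share
a clique on which all colors occur. -/
theorem IsColoringOn.star_eq_of_adj [DecidableEq α] {n : ℕ} {A : Set V}
    (hA : ∀ x ∈ A, SphereOn G n (A ∩ G.neighborSet x)) {S : Finset α} (hS : S.card = n + 1)
    {C C' : V → α} (hC : IsColoringOn G A S C)
    (hloc : ∀ x ∈ A, ∃ σ : α → α, ∀ w ∈ A, (w = x ∨ G.Adj x w) → C' w = σ (C w))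
    (τ : α → α) {u v : V} (hu : u ∈ A) (hv : v ∈ A) (huv : G.Adj u v)
    (h : ∀ w ∈ A, (w = u ∨ G.Adj u w) → C' w = τ (C w)) :
    ∀ w ∈ A, (w = v ∨ G.Adj v w) → C' w = τ (C w) := by
  obtain ⟨σ, hσ⟩ := hloc v hv
  suffices hστ : ∀ i ∈ S, σ i = τ i by
    intro w hw hvw
    rw [hσ w hw hvw, hστ _ (hC.mem w hw)]
  intro i hi
  obtain ⟨w, hw, huw, hvw, rfl⟩ :
      ∃ w ∈ A, (w = u ∨ G.Adj u w) ∧ (w = v ∨ G.Adj v w) ∧ C w = i := by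
    by_cases hui : C u = i
    · exact ⟨u, hu, Or.inl rfl, Or.inr huv.symm, hui⟩
    obtain _ | n := n
    · have : v ∈ A ∩ G.neighborSet u := ⟨hv, huv⟩
      rw [show A ∩ G.neighborSet u = ∅ from hA u hu] at this
      exact this.elim
    · obtain ⟨w, hw, hvw, hi⟩ := (hC.inter_neighborSet hu).exists_mem_star (hA u hu).1
        (by rw [Finset.card_erase_of_mem (hC.mem u hu), hS, Nat.add_sub_cancel])
        (x := v) ⟨hv, huv⟩ (Finset.mem_erase.2 ⟨Ne.symm hui, hi⟩)
      exact ⟨w, hw.1, Or.inr hw.2, hvw, hi⟩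
  rw [← hσ w hw hvw, h w hw huw]

/-- A map of colors from `C` to `C'` on the unit sphere of `x` extends to the closed star of `x`. -/
theorem IsColoringOn.exists_star_map [DecidableEq α] {A : Set V} {S : Finset α} {C C' : V → α}
    (hC : IsColoringOn G A S C) {x : V} (hx : x ∈ A)
    (h : ∃ σ : α → α, ∀ v ∈ A ∩ G.neighborSet x, C' v = σ (C v)) :
    ∃ σ : α → α, ∀ w ∈ A, (w = x ∨ G.Adj x w) → C' w = σ (C w) := by
  obtain ⟨σ, hσ⟩ := h
  refine ⟨Function.update σ (C x) (C' x), ?_⟩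
  rintro w hw (rfl | hxw)
  · rw [Function.update_self]
  · rw [Function.update_of_ne (hC.ne x hx w hw hxw).symm, hσ w ⟨hw, hxw⟩]

/-- An `(n - 1)`-sphere has at most one coloring with `n` colors, up to renaming the colors. -/
theorem SphereOn.exists_color_map [DecidableEq α] {n : ℕ} {A : Set V} (hA : SphereOn G n A)
    {S S' : Finset α} (hS : S.card = n) (hS' : S'.card = n) {C C' : V → α}
    (hC : IsColoringOn G A S C) (hC' : IsColoringOn G A S' C') :
    ∃ σ : α → α, ∀ v ∈ A, C' v = σ (C v) := by
  induction n generalizing A S S' with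
  | zero => exact ⟨id, fun v hv => by rw [show A = ∅ from hA] at hv; exact hv.elim⟩
  | succ n ih =>
    have hloc : ∀ x ∈ A, ∃ σ : α → α, ∀ w ∈ A, (w = x ∨ G.Adj x w) → C' w = σ (C w) := by
      intro x hx
      refine hC.exists_star_map hx (ih (hA.1 x hx) ?_ ?_ (hC.inter_neighborSet hx)
        (hC'.inter_neighborSet hx))
      · rw [Finset.card_erase_of_mem (hC.mem x hx), hS, Nat.add_sub_cancel]
      · rw [Finset.card_erase_of_mem (hC'.mem x hx), hS', Nat.add_sub_cancel]
    obtain _ | n := n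
    · obtain ⟨a, rfl⟩ := Finset.card_eq_one.1 hS'
      exact ⟨fun _ => a, fun v hv => Finset.mem_singleton.1 (hC'.mem v hv)⟩
    · obtain ⟨x, hx⟩ := hA.nonempty
      obtain ⟨σ, hσ⟩ := hloc x hx
      refine ⟨σ, fun v hv => ?_⟩
      exact hA.forall_of_adj (fun u => ∀ w ∈ A, (w = u ∨ G.Adj u w) → C' w = σ (C w))
        (fun u hu v hv huv h => hC.star_eq_of_adj hA.1 hS hloc σ hu hv huv h)
        x hx v hv hσ v hv (Or.inl rfl)

/-- A `d`-colorable graph whose unit spheres are `(d - 2)`-spheres has `d!` colorings with `d`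
colors for each connected component. -/
theorem natCard_coloring_of_sphereOn [Finite V] (n : ℕ)
    (hG : ∀ x, SphereOn G n (G.neighborSet x)) (C₀ : G.Coloring (Fin (n + 1))) :
    Nat.card (G.Coloring (Fin (n + 1))) =
      (n + 1).factorial ^ Nat.card G.ConnectedComponent := by
  have hA : ∀ x ∈ (Set.univ : Set V), SphereOn G n (Set.univ ∩ G.neighborSet x) := fun x _ => by
    rw [Set.univ_inter]
    exact hG x
  have hcol : ∀ C : G.Coloring (Fin (n + 1)), IsColoringOn G Set.univ Finset.univ C := fun C =>
    ⟨fun _ _ => Finset.mem_univ _, fun _ _ _ _ h => C.valid h⟩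
  have hcard : (Finset.univ : Finset (Fin (n + 1))).card = n + 1 := Finset.card_fin _
  have hstar := fun (C : G.Coloring (Fin (n + 1))) (x : V) (i : Fin (n + 1)) =>
    (hcol C).exists_mem_star hA hcard (Set.mem_univ x) (Finset.mem_univ i)
  let Φ : (G.ConnectedComponent → Equiv.Perm (Fin (n + 1))) → G.Coloring (Fin (n + 1)) := fun τ =>
    SimpleGraph.Coloring.mk (fun v => τ (G.connectedComponentMk v) (C₀ v)) fun {u v} h => by
      rw [SimpleGraph.ConnectedComponent.sound h.reachable]
      exact fun he => C₀.valid h ((τ _).injective he)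
  have hΦ : ∀ τ v, Φ τ v = τ (G.connectedComponentMk v) (C₀ v) := fun _ _ => rfl
  have hinj : Function.Injective Φ := by
    intro τ τ' h
    funext K
    induction K using SimpleGraph.ConnectedComponent.ind with
    | h x =>
      ext1 i
      obtain ⟨w, -, hw, rfl⟩ := hstar C₀ x i
      have hK : G.connectedComponentMk x = G.connectedComponentMk w := by
        rcases hw with rfl | hw
        · rfl
        · exact SimpleGraph.ConnectedComponent.sound hw.reachable
      rw [hK, ← hΦ, ← hΦ, h]
  have hsurj : Function.Surjective Φ := by
    intro C
    have hloc : ∀ x ∈ (Set.univ : Set V), ∃ σ : Fin (n + 1) → Fin (n + 1),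
        ∀ w ∈ (Set.univ : Set V), (w = x ∨ G.Adj x w) → C w = σ (C₀ w) := fun x hx =>
      (hcol C₀).exists_star_map hx <| (hA x hx).exists_color_map
        (by rw [Finset.card_erase_of_mem (Finset.mem_univ _), hcard, Nat.add_sub_cancel])
        (by rw [Finset.card_erase_of_mem (Finset.mem_univ _), hcard, Nat.add_sub_cancel])
        ((hcol C₀).inter_neighborSet hx) ((hcol C).inter_neighborSet hx)
    have hcomp : ∀ K : G.ConnectedComponent, ∃ τ : Equiv.Perm (Fin (n + 1)),
        ∀ v, G.connectedComponentMk v = K → C v = τ (C₀ v) := by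
      intro K
      induction K using SimpleGraph.ConnectedComponent.ind with
      | h x =>
        obtain ⟨σ, hσ⟩ := hloc x (Set.mem_univ x)
        have hσsurj : Function.Surjective σ := fun i => by
          obtain ⟨w, hw, hxw, rfl⟩ := hstar C x i
          exact ⟨C₀ w, (hσ w hw hxw).symm⟩
        refine ⟨Equiv.ofBijective σ ⟨Finite.injective_iff_surjective.2 hσsurj, hσsurj⟩, ?_⟩
        intro v hv
        obtain ⟨p⟩ := (SimpleGraph.ConnectedComponent.exact hv).symm
        have hwalk : ∀ {a b : V} (_ : G.Walk a b),
            (∀ w ∈ (Set.univ : Set V), (w = a ∨ G.Adj a w) → C w = σ (C₀ w)) →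
            ∀ w ∈ (Set.univ : Set V), (w = b ∨ G.Adj b w) → C w = σ (C₀ w) := by
          intro a b p
          induction p with
          | nil => exact id
          | cons h p ih =>
            exact fun ha => ih ((hcol C₀).star_eq_of_adj hA hcard hloc σ (Set.mem_univ _)
              (Set.mem_univ _) h ha)
        exact hwalk p hσ v (Set.mem_univ v) (Or.inl rfl)
    choose τ hτ using hcomp
    refine ⟨τ, ?_⟩
    ext1 v
    exact (hτ _ v rfl).symm
  rw [← Nat.card_congr (Equiv.ofBijective Φ ⟨hinj, hsurj⟩), Nat.card_fun, Nat.card_perm,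
    Nat.card_fin]

end Colorings

/-! ### Level surfaces -/

section LevelSurface

variable {V : Type u} {G : SimpleGraph V} {f : V → ℝ} {c : ℝ}

/-- The level surface as an induced subgraph of the comparability graph of all finite sets of
vertices. -/
def levelSurfaceEmbedding (G : SimpleGraph V) (f : V → ℝ) (c : ℝ) :
    levelSurface G f c ↪g comparabilityGraph (Finset V) where
  toFun := Subtype.val
  inj' := Subtype.val_injective
  map_rel_iff' := Iff.rfl

/-- As `c` is not a value of `f`, a simplex belongs to the level surface exactly if it has vertices
on both sides. -/
theorem range_levelSurfaceEmbedding (hc : c ∉ Set.range f) :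
    Set.range (levelSurfaceEmbedding G f c) =
      {t : Finset V | G.IsClique (t : Set V) ∧ IsMixed (fun v => f v - c < 0) t} := by
  have hpos : ∀ v, 0 < f v - c ↔ ¬ f v - c < 0 := fun v =>
    ⟨fun h => h.not_gt, fun h => (not_lt.1 h).lt_of_ne fun h0 => hc ⟨v, (sub_eq_zero.1 h0.symm)⟩⟩
  ext t
  constructor
  · rintro ⟨⟨t, ht, hn, v, hv, hp⟩, rfl⟩
    exact ⟨ht, hn, v, hv, (hpos v).1 hp⟩
  · rintro ⟨ht, hn, v, hv, hp⟩
    exact ⟨⟨t, ht, hn, v, hv, (hpos v).2 hp⟩, rfl⟩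

theorem IsDGraph.exists_sphereOn_commonLink {d : ℕ} (hG : IsDGraph (d : ℤ) G) {t : Finset V}
    (ht : G.IsClique (t : Set V)) (hne : t.Nonempty) :
    ∃ m, m + t.card = d + 1 ∧ SphereOn G m (commonLink G t) := by
  obtain ⟨v, hv⟩ := hne
  obtain ⟨n, hn, h⟩ := hG.sphereOn_neighborSet v
  obtain rfl : n = d := by exact_mod_cast hn
  have hl : commonLink G {v} = G.neighborSet v := by
    ext w
    simp [commonLink]
  rw [← hl] at h
  simpa using h.commonLink_of_subset (Finset.singleton_subset_iff.2 hv) ht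

theorem LevelSimplex.two_le_card (t : LevelSimplex G f c) : 2 ≤ t.1.card := by
  obtain ⟨t, -, ⟨v, hv, hn⟩, w, hw, hp⟩ := t
  refine Finset.one_lt_card.2 ⟨v, hv, w, hw, ?_⟩
  rintro rfl
  exact hn.not_gt hp

theorem LevelSimplex.nonempty (t : LevelSimplex G f c) : t.1.Nonempty :=
  let ⟨v, hv, _⟩ := t.2.2.1
  ⟨v, hv⟩

/-- The unit sphere of a simplex `t` in the level surface is the join of the mixed proper faces of
`t` with the barycentric refinement of the link of `t`. -/
theorem sphereOn_levelSurface [Finite V] {d : ℕ} (hG : IsDGraph (d : ℤ) G)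
    (hc : c ∉ Set.range f) (t : LevelSimplex G f c) :
    ∃ n, n + 1 = d ∧ SphereOn (comparabilityGraph (Finset V)) n
      (Set.range (levelSurfaceEmbedding G f c) ∩
        (comparabilityGraph (Finset V)).neighborSet t.1) := by
  obtain ⟨m, hm, hlink⟩ := hG.exists_sphereOn_commonLink t.2.1 t.nonempty
  have h2 := t.two_le_card
  have htr : t.1 ∈ Set.range (levelSurfaceEmbedding G f c) := ⟨t, rfl⟩
  rw [range_levelSurfaceEmbedding hc] at htr ⊢
  obtain ⟨htc, htm⟩ := htr
  refine ⟨t.1.card - 2 + m, by omega, SphereOn.inter_neighborSet ?_ ?_ rfl⟩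
  · convert sphereOn_mixed_faces (fun v => f v - c < 0) (t.1.card - 2) t.1 htm (by omega) using 1
    ext s
    exact ⟨fun h => ⟨h.2, h.1.2⟩,
      fun h => ⟨⟨htc.subset (Finset.coe_subset.2 h.1.subset), h.2⟩, h.1⟩⟩
  · convert hlink.cliques_ssuperset m t.1 htc using 1
    ext s
    exact ⟨fun h => ⟨h.2, h.1.1⟩, fun h => ⟨⟨h.2, htm.mono h.1.subset⟩, h.1⟩⟩

theorem isDGraph_levelSurface [Finite V] {d : ℕ} (hG : IsDGraph (d : ℤ) G)
    (hc : c ∉ Set.range f) : IsDGraph ((d : ℤ) - 1) (levelSurface G f c) := by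
  refine ⟨inferInstance, fun t => ?_⟩
  obtain ⟨n, rfl, h⟩ := sphereOn_levelSurface hG hc t
  have := SphereOn.isSphere (unitSphereEmbedding (levelSurfaceEmbedding G f c) t)
    (by rw [range_unitSphereEmbedding]; exact h)
  simpa using this

/-- The coloring of the level surface by the dimension of simplices. -/
theorem exists_coloring_simplexDim [Finite V] {d : ℕ} (hG : IsDGraph (d : ℤ) G) :
    ∃ C : (levelSurface G f c).Coloring (Set.Icc 1 d),
      ∀ s : LevelSimplex G f c, (C s : ℕ) = simplexDim s.1 := by
  refine ⟨SimpleGraph.Coloring.mk (fun s => ⟨simplexDim s.1, ?_⟩) ?_, fun s => rfl⟩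
  · obtain ⟨m, hm, -⟩ := hG.exists_sphereOn_commonLink s.2.1 s.nonempty
    have := s.two_le_card
    rw [simplexDim, Set.mem_Icc]
    omega
  · intro s t hst he
    have hs := s.two_le_card
    have ht := t.two_le_card
    have he' : s.1.card - 1 = t.1.card - 1 := congrArg Subtype.val he
    rcases hst with h | h
    · have := Finset.card_lt_card h
      omega
    · have := Finset.card_lt_card h
      omega

end LevelSurface

theorem mainTheorem4 {V : Type*} [Finite V] (d : ℕ) (G : SimpleGraph V)
    (hG : IsDGraph (d : ℤ) G) (f : V → ℝ) (c : ℝ) (hc : c ∉ Set.range f) :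
    IsDGraph ((d : ℤ) - 1) (levelSurface G f c) ∧
    (∃ C : (levelSurface G f c).Coloring (Set.Icc 1 d),
      ∀ s : LevelSimplex G f c, (C s : ℕ) = simplexDim s.1) ∧
    (levelSurface G f c).Colorable d ∧
    ((levelSurface G f c).Connected →
      (chromaticPolynomial (levelSurface G f c)).eval (d : ℤ) = (d.factorial : ℤ)) ∧
    (chromaticPolynomial (levelSurface G f c)).eval (d : ℤ) =
      (d.factorial : ℤ) ^ Nat.card (levelSurface G f c).ConnectedComponent := by
  have hH := isDGraph_levelSurface hG hc
  have hcol : (levelSurface G f c).Colorable d := by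
    obtain ⟨C, -⟩ := exists_coloring_simplexDim (f := f) (c := c) hG
    simpa using C.colorable
  have hcount : (chromaticPolynomial (levelSurface G f c)).eval (d : ℤ) =
      (d.factorial : ℤ) ^ Nat.card (levelSurface G f c).ConnectedComponent := by
    rw [chromaticPolynomial_eval]
    obtain ⟨C₀⟩ := hcol
    obtain _ | n := d
    · -- there are no colors, so the level surface is empty
      have hempty : IsEmpty (LevelSimplex G f c) := ⟨fun s => (C₀ s).elim0⟩
      have : IsEmpty (levelSurface G f c).ConnectedComponent :=
        ⟨fun K => K.ind fun v => hempty.elim v⟩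
      have : Unique ((levelSurface G f c).Coloring (Fin 0)) :=
        ⟨⟨C₀⟩, fun C => RelHom.ext fun v => hempty.elim v⟩
      simp
    · rw [natCard_coloring_of_sphereOn n _ C₀]
      · push_cast
        rfl
      · intro x
        obtain ⟨m, hm, h⟩ := hH.sphereOn_neighborSet x
        obtain rfl : m = n := by simpa using hm
        exact h
  refine ⟨hH, exists_coloring_simplexDim hG, hcol, fun hconn => ?_, hcount⟩
  have := hconn.preconnected.subsingleton_connectedComponent
  have := hconn.nonempty
  have hone : Nat.card (levelSurface G f c).ConnectedComponent = 1 :=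
    Nat.card_eq_one_iff_unique.2 ⟨inferInstance, inferInstance⟩
  rw [hcount, hone, pow_one]
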